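/- Let $n\ge 0$. A \emph{faro word} of length $n$ over the alphabet $\{0,1,\dots,n-1\}$ is a word $w=w_1w_2\cdots w_n=u_1v_1u_2v_2u_3v_3\cdots$ obtained by interlacing two nondecreasing words $u,v$ over this alphabet with $|u|+|v|=n$ and $0\le |u|-|v|\le 1$; it is \emph{subexcedent} if $w_i\le i-1$ for $1\le i\le n$. A \emph{Dumont permutation of the second kind} of length $2n$ is a permutation $\pi$ of $\{1,\dots,2n\}$ such that $\pi(2i-1)\ge 2i-1$ and $\pi(2i)\le 2i-1$ for $1\le i\le n$; it is \emph{$2143$-avoiding} if there are no indices $i_1<i_2<i_3<i_4$ with $\pi(i_2)<\pi(i_1)<\pi(i_4)<\pi(i_3)$. Let $(a_m)_{m\ge 0}$ be the sequence (OEIS A047749) given by $$a_{2m}=\frac{1}{2m+1}\binom{3m}{m},\qquad a_{2m+1}=\frac{1}{m+1}\binom{3m+1}{m}\qquad(m\ge 0).$$ Then there is a bijection between the set of subexcedent faro words of length $n$ over $\{0,1,\dots,n-1\}$ and the set of $2143$-avoiding Dumont permutations of the second kind of length $2n$. Moreover, each of these two sets has exactly $a_n a_{n+1}$ elements. -/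

import Mathlib

/-- The faro shuffle `u₁v₁u₂v₂u₃v₃…` of two words. The conditions `0 ≤ |u| - |v| ≤ 1` and
`|u| + |v| = n` amount to `|u| = ⌈n/2⌉` and `|v| = ⌊n/2⌋`. Positions are numbered from `0`, so
the letters of `u` occupy the even indices. -/
def faroShuffle {n : ℕ} {α : Type*} (u : Fin ((n + 1) / 2) → α) (v : Fin (n / 2) → α) :
    Fin n → α := fun j =>
  if h : (j : ℕ) % 2 = 0 then
    u ⟨(j : ℕ) / 2, by have := j.isLt; omega⟩
  else
    v ⟨(j : ℕ) / 2, by have := j.isLt; omega⟩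

/-- A `k`-ary faro word of length `n`, over the alphabet `{0, …, k - 1}`: a faro shuffle of two
nondecreasing words. -/
def IsFaroWord {n k : ℕ} (w : Fin n → Fin k) : Prop :=
  ∃ (u : Fin ((n + 1) / 2) → Fin k) (v : Fin (n / 2) → Fin k),
    Monotone u ∧ Monotone v ∧ w = faroShuffle u v

/-- Subexcedent words: `w_i ≤ i - 1` for positions `i` numbered from `1`, that is, `w i ≤ i` for
positions numbered from `0`. -/
def IsSubexcedent {n : ℕ} (w : Fin n → Fin n) : Prop :=
  ∀ i : Fin n, w i ≤ i

/-- The subexcedent faro words of length `n` over the alphabet `{0, …, n - 1}`. -/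
def SubexcedentFaroWord (n : ℕ) : Type :=
  {w : Fin n → Fin n // IsFaroWord w ∧ IsSubexcedent w}

/-- Dumont permutations of the second kind. With positions and values numbered from `1` the
conditions are `π(2i-1) ≥ 2i-1` and `π(2i) ≤ 2i-1`, that is, `p ≤ π p` at odd positions and
`π p < p` at even positions. Here positions and values are numbered from `0`, so the parity of
the positions is exchanged. -/
def IsDumontSecondKind {n : ℕ} (π : Equiv.Perm (Fin (2 * n))) : Prop :=
  ∀ p : Fin (2 * n), (Even (p : ℕ) → p ≤ π p) ∧ (Odd (p : ℕ) → π p < p)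

/-- Avoidance of the classical pattern `2143`. -/
def Avoids2143 {N : ℕ} (π : Equiv.Perm (Fin N)) : Prop :=
  ¬ ∃ i₁ i₂ i₃ i₄ : Fin N, i₁ < i₂ ∧ i₂ < i₃ ∧ i₃ < i₄ ∧
    π i₂ < π i₁ ∧ π i₁ < π i₄ ∧ π i₄ < π i₃

/-- The `2143`-avoiding Dumont permutations of the second kind of length `2n`. -/
def DumontAvoiding2143 (n : ℕ) : Type :=
  {π : Equiv.Perm (Fin (2 * n)) // IsDumontSecondKind π ∧ Avoids2143 π}

/-- The sequence `1, 1, 1, 2, 3, 7, 12, 30, 55, …` with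
`a (2m) = (3m choose m) / (2m + 1)` and `a (2m + 1) = (3m + 1 choose m) / (m + 1)`
(division of rational numbers). -/
def seqA047749 (j : ℕ) : ℚ :=
  if j % 2 = 0 then
    (Nat.choose (3 * (j / 2)) (j / 2) : ℚ) / (2 * ((j / 2 : ℕ) : ℚ) + 1)
  else
    (Nat.choose (3 * (j / 2) + 1) (j / 2) : ℚ) / (((j / 2 : ℕ) : ℚ) + 1)

/-! Both sets split as products of two families counted by ballot numbers, which satisfy a Pascal
recurrence with a vanishing boundary (`ballot_succ_succ`, `ballot_diag`) and give `a_n` as `ballot n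
(n / 2)`. The bijection itself is not constructed; it follows from equal cardinalities.

A faro word is subexcedent exactly when its two nondecreasing parts stay under lines of slope two,
and such sequences are lattice paths (`BoundedMonotone.card_eq`).

For a 2143-avoiding Dumont permutation, with positions counted from zero, every value at an odd
position is below every value at an even one (`apply_oddPos_lt_apply_evenPos`). So odd positions
carry the lower half of the values, and the permutation is a pair `(e, o)`, where `o` is read
backwards and upside down. The Dumont condition becomes `e i ≤ 2 i` and `o i ≤ 2 i + 1`, and
2143-avoidance becomes 213-avoidance of both. Bounded 213-avoiders, refined by an initial increasing
run, obey the ballot recurrence (`ncard_risingAvoiders`). -/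

/-! ### Ballot numbers -/

/-- The number `(n + 1 - 2 s) / (n + 1 + s) * (n + 1 + s choose s)` of lattice paths of slope-two
ballot type, in division-free form. -/
def ballot (n : ℕ) : ℕ → ℤ
  | 0 => 1
  | s + 1 => (n + s + 1).choose (s + 1) - 2 * (n + s + 1).choose s

lemma ballot_succ_succ (n s : ℕ) :
    ballot (n + 1) (s + 1) = ballot (n + 1) s + ballot n (s + 1) := by
  cases s with
  | zero => simp [ballot]; ring
  | succ s =>
    simp only [ballot]
    have h1 := Nat.choose_succ_succ (n + (s + 1) + 1) (s + 1)
    have h2 := Nat.choose_succ_succ (n + (s + 1) + 1) s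
    rw [show n + 1 + (s + 1) + 1 = (n + (s + 1) + 1) + 1 by ring,
      show n + 1 + s + 1 = n + (s + 1) + 1 by ring, h1, h2]
    push_cast
    ring

lemma ballot_diag (s : ℕ) : ballot (2 * s + 1) (s + 1) = 0 := by
  have h := Nat.choose_succ_right_eq (2 * s + 1 + s + 1) s
  rw [show 2 * s + 1 + s + 1 - s = 2 * (s + 1) by omega] at h
  have h' : (2 * s + 1 + s + 1).choose (s + 1) = 2 * (2 * s + 1 + s + 1).choose s := by
    refine Nat.eq_of_mul_eq_mul_right (Nat.succ_pos s) ?_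
    simp only [Nat.succ_eq_add_one]
    rw [h]; ring
  simp [ballot, h']

lemma ballot_half (n : ℕ) : (ballot n (n / 2) : ℚ) = seqA047749 n := by
  obtain ⟨m, rfl | rfl⟩ : ∃ m, n = 2 * m ∨ n = 2 * m + 1 := ⟨n / 2, by omega⟩
  · have h0 : 2 * m / 2 = m := by omega
    have h1 : 2 * m % 2 = 0 := by omega
    simp only [seqA047749, h0, h1, if_true]
    rw [eq_div_iff (by positivity)]
    cases m with
    | zero => simp [ballot]
    | succ s =>
      have h := Nat.choose_succ_right_eq (3 * (s + 1)) s
      rw [show 3 * (s + 1) - s = 2 * s + 3 by omega] at h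
      have h : ((3 * (s + 1)).choose (s + 1) : ℚ) * (s + 1) =
        (3 * (s + 1)).choose s * (2 * s + 3) := by exact_mod_cast h
      simp only [ballot]
      rw [show 2 * (s + 1) + s + 1 = 3 * (s + 1) by ring]
      push_cast
      linear_combination 2 * h
  · have h0 : (2 * m + 1) / 2 = m := by omega
    have h1 : (2 * m + 1) % 2 = 1 := by omega
    simp only [seqA047749, h0, h1, one_ne_zero, if_false]
    rw [eq_div_iff (by positivity)]
    cases m with
    | zero => simp [ballot]
    | succ s =>
      have h := Nat.choose_succ_right_eq (3 * (s + 1) + 1) s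
      rw [show 3 * (s + 1) + 1 - s = 2 * s + 4 by omega] at h
      have h : ((3 * (s + 1) + 1).choose (s + 1) : ℚ) * (s + 1) =
        (3 * (s + 1) + 1).choose s * (2 * s + 4) := by exact_mod_cast h
      simp only [ballot]
      rw [show 2 * (s + 1) + 1 + s + 1 = 3 * (s + 1) + 1 by ring]
      push_cast
      linear_combination h

/-! ### Nondecreasing sequences under a line of slope two -/

/-- Nondecreasing sequences of length `m` under the line `i ↦ 2 i + d`. -/
def BoundedMonotone (m d : ℕ) : Type :=
  {u : Fin m → ℕ // Monotone u ∧ ∀ i, u i < 2 * (i : ℕ) + d}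

namespace BoundedMonotone

instance (m d : ℕ) : Finite (BoundedMonotone m d) := by
  refine Finite.of_injective
    (fun u : BoundedMonotone m d => fun i : Fin m => (⟨u.1 i, by
      have := u.2.2 i; have := i.isLt; omega⟩ : Fin (2 * m + d))) ?_
  intro u v h
  apply Subtype.ext
  funext i
  exact congrArg Fin.val (congrFun h i)

lemma card_zero (d : ℕ) : Nat.card (BoundedMonotone 0 d) = 1 := by
  rw [Nat.card_eq_one_iff_unique]
  exact ⟨⟨fun u v => Subtype.ext (Subsingleton.elim _ _)⟩,
    ⟨⟨Fin.elim0, fun i => i.elim0, fun i => i.elim0⟩⟩⟩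

lemma card_succ_zero (m : ℕ) : Nat.card (BoundedMonotone (m + 1) 0) = 0 := by
  have : IsEmpty (BoundedMonotone (m + 1) 0) := ⟨fun u => by simpa using u.2.2 0⟩
  exact Nat.card_of_isEmpty

/-- Prepend a zero. -/
def consZero {m d : ℕ} (u : BoundedMonotone m (d + 3)) : BoundedMonotone (m + 1) (d + 1) :=
  ⟨Fin.cons 0 u.1, by
    refine Fin.monotone_iff_le_succ.2 fun i => ?_
    cases m with
    | zero => exact i.elim0
    | succ m =>
      induction i using Fin.cases with
      | zero => simp
      | succ i =>
        rw [← Fin.succ_castSucc, Fin.cons_succ, Fin.cons_succ]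
        exact u.2.1 (Fin.castSucc_lt_succ).le, by
    intro i
    induction i using Fin.cases with
    | zero => simp
    | succ i =>
      have := u.2.2 i
      simp only [Fin.cons_succ, Fin.val_succ]
      omega⟩

/-- Raise all letters by one. -/
def shift {m d : ℕ} (u : BoundedMonotone m d) : BoundedMonotone m (d + 1) :=
  ⟨fun i => u.1 i + 1, fun i j h => Nat.succ_le_succ (u.2.1 h), fun i => by
    have := u.2.2 i
    show u.1 i + 1 < _
    omega⟩

/-- Either the first letter is zero, and deleting it shifts indices by one and so raises the line by
two, or all letters are positive and can be lowered by one. -/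
lemma card_succ_succ (m d : ℕ) :
    Nat.card (BoundedMonotone (m + 1) (d + 1)) =
      Nat.card (BoundedMonotone m (d + 3)) + Nat.card (BoundedMonotone (m + 1) d) := by
  rw [← Nat.card_sum]
  refine (Nat.card_congr (Equiv.ofBijective (Sum.elim consZero shift) ⟨?_, ?_⟩)).symm
  · rintro (u | u) (v | v) h
    · have h := congrArg Subtype.val h
      exact congrArg Sum.inl (Subtype.ext (Fin.cons_right_injective (α := fun _ => ℕ) 0 h))
    · have h := congrFun (congrArg Subtype.val h) 0
      simp [consZero, shift] at h
    · have h := congrFun (congrArg Subtype.val h) 0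
      simp [consZero, shift] at h
    · have h := congrArg Subtype.val h
      refine congrArg Sum.inr (Subtype.ext (funext fun i => ?_))
      exact Nat.succ_injective (congrFun h i)
  · intro w
    by_cases h0 : w.1 0 = 0
    · refine ⟨Sum.inl ⟨fun i => w.1 i.succ, fun i j h => w.2.1 (Fin.succ_le_succ_iff.2 h),
        fun i => ?_⟩, Subtype.ext ?_⟩
      · have := w.2.2 i.succ
        simp only [Fin.val_succ] at this ⊢
        omega
      · funext i
        induction i using Fin.cases with
        | zero => exact h0.symm
        | succ i => rfl
    · have hpos : ∀ i, 0 < w.1 i := fun i =>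
        (Nat.pos_of_ne_zero h0).trans_le (w.2.1 (Fin.zero_le i))
      refine ⟨Sum.inr ⟨fun i => w.1 i - 1, fun i j h => Nat.sub_le_sub_right (w.2.1 h) 1,
        fun i => ?_⟩, Subtype.ext ?_⟩
      · have := w.2.2 i
        have := hpos i
        show w.1 i - 1 < _
        omega
      · funext i
        exact Nat.sub_add_cancel (hpos i)

lemma card_eq (m d : ℕ) (hd : 0 < 2 * m + d) :
    (Nat.card (BoundedMonotone m d) : ℤ) = ballot (2 * m + d - 1) m := by
  induction m generalizing d with
  | zero => simp [card_zero, ballot]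
  | succ m ih =>
    induction d with
    | zero =>
      rw [card_succ_zero, show 2 * (m + 1) + 0 - 1 = 2 * m + 1 by omega, ballot_diag]
      rfl
    | succ d ihd =>
      rw [card_succ_succ, Nat.cast_add, ih _ (by omega), ihd (by omega),
        show 2 * (m + 1) + (d + 1) - 1 = (2 * m + d + 1) + 1 by omega, ballot_succ_succ,
        show 2 * (m + 1) + d - 1 = 2 * m + d + 1 by omega]
      rfl

end BoundedMonotone

/-! ### Subexcedent faro words as pairs of sequences -/

section Faro

lemma faroShuffle_even {n : ℕ} {α : Type*} (u : Fin ((n + 1) / 2) → α) (v : Fin (n / 2) → α)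
    (i : Fin ((n + 1) / 2)) (h : 2 * (i : ℕ) < n) : faroShuffle u v ⟨2 * i, h⟩ = u i := by
  simp [faroShuffle]

lemma faroShuffle_odd {n : ℕ} {α : Type*} (u : Fin ((n + 1) / 2) → α) (v : Fin (n / 2) → α)
    (i : Fin (n / 2)) (h : 2 * (i : ℕ) + 1 < n) : faroShuffle u v ⟨2 * i + 1, h⟩ = v i := by
  have h2 : (2 * (i : ℕ) + 1) / 2 = i := by omega
  simp [faroShuffle, h2, Nat.add_mod]

/-- The subexcedent faro word with given even and odd parts. -/
def SubexcedentFaroWord.ofParts {n : ℕ}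
    (p : BoundedMonotone ((n + 1) / 2) 1 × BoundedMonotone (n / 2) 2) : SubexcedentFaroWord n :=
  ⟨faroShuffle
    (fun i => ⟨p.1.1 i, by have := p.1.2.2 i; have := i.isLt; omega⟩)
    (fun i => ⟨p.2.1 i, by have := p.2.2.2 i; have := i.isLt; omega⟩),
   ⟨_, _, fun _ _ h => p.1.2.1 h, fun _ _ h => p.2.2.1 h, rfl⟩, by
    intro j
    rw [Fin.le_def, faroShuffle]
    split_ifs with h
    · have := p.1.2.2 ⟨(j : ℕ) / 2, by have := j.isLt; omega⟩
      simp only at this ⊢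
      omega
    · have := p.2.2.2 ⟨(j : ℕ) / 2, by have := j.isLt; omega⟩
      simp only at this ⊢
      omega⟩

lemma SubexcedentFaroWord.ofParts_bijective (n : ℕ) :
    Function.Bijective (SubexcedentFaroWord.ofParts (n := n)) := by
  constructor
  · rintro ⟨u, v⟩ ⟨u', v'⟩ h
    have h := congrArg Subtype.val h
    refine Prod.ext (Subtype.ext (funext fun i => ?_)) (Subtype.ext (funext fun i => ?_))
    · have := congrFun h ⟨2 * i, by have := i.isLt; omega⟩
      simp only [ofParts] at this
      rw [faroShuffle_even, faroShuffle_even] at this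
      exact congrArg Fin.val this
    · have := congrFun h ⟨2 * i + 1, by have := i.isLt; omega⟩
      simp only [ofParts] at this
      rw [faroShuffle_odd, faroShuffle_odd] at this
      exact congrArg Fin.val this
  · rintro ⟨w, ⟨u, v, hu, hv, rfl⟩, hw⟩
    refine ⟨⟨⟨fun i => u i, fun _ _ h => hu h, fun i => ?_⟩,
      ⟨fun i => v i, fun _ _ h => hv h, fun i => ?_⟩⟩, rfl⟩
    · have := hw ⟨2 * i, by have := i.isLt; omega⟩
      rw [faroShuffle_even, Fin.le_def] at this
      simp only at this ⊢
      omega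
    · have := hw ⟨2 * i + 1, by have := i.isLt; omega⟩
      rw [faroShuffle_odd, Fin.le_def] at this
      simp only at this ⊢
      omega

lemma card_subexcedentFaroWord (n : ℕ) :
    (Nat.card (SubexcedentFaroWord n) : ℚ) = seqA047749 n * seqA047749 (n + 1) := by
  rw [← Nat.card_congr (Equiv.ofBijective _ (SubexcedentFaroWord.ofParts_bijective n)),
    Nat.card_prod, ← ballot_half, ← ballot_half]
  have h1 := BoundedMonotone.card_eq ((n + 1) / 2) 1 (by omega)
  have h2 := BoundedMonotone.card_eq (n / 2) 2 (by omega)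
  rw [← Int.cast_mul, ← Int.cast_natCast, Nat.cast_mul, h1, h2]
  obtain ⟨m, rfl | rfl⟩ : ∃ m, n = 2 * m ∨ n = 2 * m + 1 := ⟨n / 2, by omega⟩
  · rw [show (2 * m + 1) / 2 = m by omega, show 2 * m / 2 = m by omega]
    rfl
  · rw [show (2 * m + 1 + 1) / 2 = m + 1 by omega, show (2 * m + 1) / 2 = m by omega, mul_comm]
    rfl

end Faro

/-! ### Counting bounded 213-avoiders -/

/-- Avoidance of the classical pattern `213`. -/
def Avoids213 {n : ℕ} (σ : Equiv.Perm (Fin n)) : Prop :=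
  ∀ i j k : Fin n, i < j → j < k → σ j < σ i → ¬ σ i < σ k

/-- The `213`-avoiding permutations with `σ i ≤ 2 i + c`. -/
def boundedAvoiders (c n : ℕ) : Set (Equiv.Perm (Fin n)) :=
  {σ | (∀ i, (σ i : ℕ) ≤ 2 * (i : ℕ) + c) ∧ Avoids213 σ}

/-- The members of `boundedAvoiders c n` that increase on the first `k` positions. -/
def risingAvoiders (c n k : ℕ) : Set (Equiv.Perm (Fin n)) :=
  {σ | σ ∈ boundedAvoiders c n ∧ ∀ i j : Fin n, i < j → (j : ℕ) < k → σ i < σ j}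

/-- Insert a new maximum at position `k`. -/
def insertMax {n : ℕ} (k : Fin (n + 1)) (τ : Equiv.Perm (Fin n)) : Equiv.Perm (Fin (n + 1)) :=
  (finSuccEquiv' k).trans ((Equiv.optionCongr τ).trans (finSuccEquiv' (Fin.last n)).symm)

@[simp] lemma insertMax_self {n : ℕ} (k : Fin (n + 1)) (τ : Equiv.Perm (Fin n)) :
    insertMax k τ k = Fin.last n := by
  simp [insertMax]

@[simp] lemma insertMax_succAbove {n : ℕ} (k : Fin (n + 1)) (τ : Equiv.Perm (Fin n)) (i : Fin n) :
    insertMax k τ (k.succAbove i) = (τ i).castSucc := by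
  simp [insertMax]

lemma insertMax_injective {n : ℕ} (k : Fin (n + 1)) :
    Function.Injective (insertMax k : Equiv.Perm (Fin n) → _) := by
  intro τ τ' h
  ext i
  have := congrArg (fun σ : Equiv.Perm (Fin (n + 1)) => (σ (k.succAbove i) : ℕ)) h
  simpa using this

lemma exists_insertMax_eq {n : ℕ} (k : Fin (n + 1)) (σ : Equiv.Perm (Fin (n + 1)))
    (h : σ k = Fin.last n) : ∃ τ, insertMax k τ = σ := by
  have hne : ∀ i, σ (k.succAbove i) ≠ Fin.last n := fun i hi =>
    Fin.succAbove_ne k i (σ.injective (hi.trans h.symm))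
  have hinj : Function.Injective fun i => (σ (k.succAbove i)).castPred (hne i) := by
    intro i j hij
    have := Fin.castPred_inj.1 hij
    exact Fin.succAbove_right_injective (σ.injective this)
  refine ⟨Equiv.ofBijective _ (Finite.injective_iff_bijective.1 hinj), Equiv.ext fun j => ?_⟩
  rcases Fin.eq_self_or_eq_succAbove k j with rfl | ⟨i, rfl⟩
  · rw [insertMax_self, h]
  · rw [insertMax_succAbove]
    simp

lemma val_succAbove_lt_iff {n : ℕ} (k : Fin (n + 1)) (i : Fin n) :
    k.succAbove i < k ↔ (i : ℕ) < k := by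
  rw [Fin.succAbove_lt_iff_castSucc_lt, Fin.lt_def]
  rfl

/-- The new maximum can only play the 3 of a 213, so the sole new constraint is that there be no
descent pair before it. -/
lemma insertMax_mem_iff {c n : ℕ} (k : Fin (n + 1)) (hk : n ≤ 2 * (k : ℕ) + c)
    (τ : Equiv.Perm (Fin n)) :
    insertMax k τ ∈ boundedAvoiders c (n + 1) ↔ τ ∈ risingAvoiders c n k := by
  constructor
  · rintro ⟨hb, ha⟩
    refine ⟨⟨fun i => ?_, fun i j l hij hjl h1 h2 => ?_⟩, fun i j hij hj => ?_⟩
    · by_cases hi : (i : ℕ) < k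
      · have := hb (k.succAbove i)
        rw [insertMax_succAbove, Fin.succAbove_of_castSucc_lt _ _ hi] at this
        exact this
      -- Entries right of the maximum move left on deletion, but there `hk` makes the bound
      -- automatic.
      · have := (τ i).isLt
        omega
    · refine ha (k.succAbove i) (k.succAbove j) (k.succAbove l) ?_ ?_ ?_ ?_ <;> simpa
    · by_contra hlt
      have hne : τ j ≠ τ i := fun h => hij.ne' (τ.injective h)
      have hji : τ j < τ i := lt_of_le_of_ne (not_lt.1 hlt) hne
      refine ha (k.succAbove i) (k.succAbove j) k ?_ ?_ ?_ ?_
      · simpa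
      · exact (val_succAbove_lt_iff k j).2 hj
      · simpa
      · simp [Fin.castSucc_lt_last]
  · rintro ⟨⟨hb, ha⟩, hr⟩
    refine ⟨fun i => ?_, fun a b d hab hbd h1 h2 => ?_⟩
    · rcases Fin.eq_self_or_eq_succAbove k i with rfl | ⟨i, rfl⟩
      · simpa using hk
      · rw [insertMax_succAbove]
        have h1 := hb i
        have h2 : (i : ℕ) ≤ (k.succAbove i : ℕ) := by
          unfold Fin.succAbove
          split_ifs <;> simp
        simp only [Fin.val_castSucc]
        omega
    · rcases Fin.eq_self_or_eq_succAbove k a with rfl | ⟨a, rfl⟩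
      · rw [insertMax_self] at h2
        exact absurd h2 (not_lt.2 (Fin.le_last _))
      rcases Fin.eq_self_or_eq_succAbove k b with rfl | ⟨b, rfl⟩
      · rw [insertMax_self] at h1
        exact absurd h1 (not_lt.2 (Fin.le_last _))
      simp only [insertMax_succAbove, Fin.succAbove_lt_succAbove_iff,
        Fin.castSucc_lt_castSucc_iff] at hab h1 h2
      rcases Fin.eq_self_or_eq_succAbove k d with rfl | ⟨d, rfl⟩
      · exact lt_asymm h1 (hr a b hab ((val_succAbove_lt_iff _ b).1 hbd))
      · simp only [insertMax_succAbove, Fin.succAbove_lt_succAbove_iff,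
          Fin.castSucc_lt_castSucc_iff] at hbd h2
        exact ha a b d hab hbd h1 h2

/-- The members of `boundedAvoiders c (n + 1)` with the maximum at position `k`. -/
def avoidersWithMaxAt (c : ℕ) {n : ℕ} (k : Fin (n + 1)) : Set (Equiv.Perm (Fin (n + 1))) :=
  {σ | σ ∈ boundedAvoiders c (n + 1) ∧ σ k = Fin.last n}

lemma ncard_avoidersWithMaxAt (c : ℕ) {n : ℕ} (k : Fin (n + 1)) :
    (avoidersWithMaxAt c k).ncard =
      if n ≤ 2 * (k : ℕ) + c then (risingAvoiders c n k).ncard else 0 := by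
  split_ifs with hk
  · rw [← Set.ncard_image_of_injective _ (insertMax_injective k)]
    congr 1
    ext σ
    constructor
    · rintro ⟨h1, h2⟩
      obtain ⟨τ, rfl⟩ := exists_insertMax_eq k σ h2
      exact ⟨τ, (insertMax_mem_iff k hk τ).1 h1, rfl⟩
    · rintro ⟨τ, h, rfl⟩
      exact ⟨(insertMax_mem_iff k hk τ).2 h, insertMax_self k τ⟩
  · rw [Set.ncard_eq_zero (Set.toFinite _), Set.eq_empty_iff_forall_notMem]
    rintro σ ⟨⟨hb, -⟩, h⟩
    have := hb k
    rw [h, Fin.val_last] at this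
    exact hk this

/-- If the initial run stops at position `k`, the descent there would form a 213 with a larger later
entry, and larger earlier entries are excluded by the run; so the maximum sits at `k`. -/
lemma risingAvoiders_succ (c : ℕ) {n : ℕ} (k : Fin n) :
    risingAvoiders c (n + 1) (k + 1) =
      risingAvoiders c (n + 1) (k + 2) ∪ avoidersWithMaxAt c k.castSucc := by
  ext σ
  constructor
  · rintro ⟨hσ, hr⟩
    by_cases hlt : σ k.castSucc < σ k.succ
    · refine Or.inl ⟨hσ, fun i j hij hj => ?_⟩
      by_cases hjk : (j : ℕ) < k + 1
      · exact hr i j hij hjk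
      · have hj' : j = k.succ := Fin.ext (by rw [Fin.val_succ]; omega)
        subst hj'
        by_cases hik : i = k.castSucc
        · rwa [hik]
        · have : i < k.castSucc := by
            rw [Fin.lt_def] at hij ⊢
            rw [Fin.ext_iff] at hik
            simp only [Fin.val_succ, Fin.val_castSucc] at *
            omega
          exact (hr i k.castSucc this (by simp)).trans hlt
    · refine Or.inr ⟨hσ, ?_⟩
      have hlt' : σ k.succ < σ k.castSucc :=
        lt_of_le_of_ne (not_lt.1 hlt) fun h => (Fin.castSucc_lt_succ (i := k)).ne' (σ.injective h)
      by_contra hne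
      obtain ⟨q, hq⟩ := σ.surjective (Fin.last n)
      have hkl : σ k.castSucc < σ q := by rw [hq]; exact lt_of_le_of_ne (Fin.le_last _) hne
      rcases lt_trichotomy q k.succ with h | h | h
      · have hqk : q ≠ k.castSucc := fun h => hkl.ne (by rw [h])
        have : q < k.castSucc := by
          rw [Fin.lt_def] at h ⊢
          rw [ne_eq, Fin.ext_iff] at hqk
          simp only [Fin.val_succ, Fin.val_castSucc] at *
          omega
        exact lt_asymm hkl (hr q k.castSucc this (by simp))
      · subst h
        exact lt_asymm hkl hlt'
      · exact hσ.2 _ _ _ Fin.castSucc_lt_succ h hlt' hkl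
  · rintro (⟨hσ, hr⟩ | ⟨hσ, hk⟩)
    · exact ⟨hσ, fun i j hij hj => hr i j hij (by omega)⟩
    · refine ⟨hσ, fun i j hij hj => ?_⟩
      by_cases hjk : j = k.castSucc
      · subst hjk
        rw [hk]
        exact lt_of_le_of_ne (Fin.le_last _) fun h => hij.ne (σ.injective (h.trans hk.symm))
      · by_contra hlt
        have hlt' : σ j < σ i :=
          lt_of_le_of_ne (not_lt.1 hlt) fun h => hij.ne' (σ.injective h)
        have hjk' : j < k.castSucc := by
          rw [Fin.lt_def]
          rw [Fin.ext_iff] at hjk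
          simp only [Fin.val_castSucc] at *
          omega
        refine hσ.2 i j k.castSucc hij hjk' hlt' ?_
        rw [hk]
        exact lt_of_le_of_ne (Fin.le_last _) fun h =>
          (hij.trans hjk').ne (σ.injective (h.trans hk.symm))

lemma ncard_risingAvoiders_succ (c : ℕ) {n : ℕ} (k : Fin n) :
    (risingAvoiders c (n + 1) (k + 1)).ncard = (risingAvoiders c (n + 1) (k + 2)).ncard +
      if n ≤ 2 * (k : ℕ) + c then (risingAvoiders c n k).ncard else 0 := by
  have := ncard_avoidersWithMaxAt c k.castSucc
  rw [Fin.val_castSucc] at this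
  rw [risingAvoiders_succ, ← this, Set.ncard_union_eq _ (Set.toFinite _) (Set.toFinite _)]
  rw [Set.disjoint_left]
  rintro σ ⟨-, hr⟩ ⟨-, hk⟩
  have := hr k.castSucc k.succ Fin.castSucc_lt_succ (by simp)
  rw [hk] at this
  exact absurd this (not_lt.2 (Fin.le_last _))

lemma risingAvoiders_self (c n : ℕ) : risingAvoiders c n n = {1} := by
  ext σ
  rw [Set.mem_singleton_iff]
  constructor
  · rintro ⟨-, hr⟩
    have hmono : StrictMono σ := fun i j h => hr i j h j.isLt
    have := (StrictMono.range_inj hmono strictMono_id).1 (by simp [σ.surjective.range_eq])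
    exact Equiv.ext fun i => congrFun this i
  · rintro rfl
    refine ⟨⟨fun i => ?_, fun i j k hij _ h => absurd h (not_lt.2 hij.le)⟩, fun i j hij _ => hij⟩
    simp only [Equiv.Perm.coe_one, id]
    omega

lemma risingAvoiders_zero_eq_one (c n : ℕ) : risingAvoiders c n 0 = risingAvoiders c n 1 := by
  ext σ
  refine and_congr_right fun _ => ⟨fun _ i j hij hj => ?_, fun _ i j _ hj => ?_⟩
  · rw [Fin.lt_def] at hij
    omega
  · omega

/-- Indexed by the number `j` of unconstrained final positions, the recurrence is that of `ballot`.
Once `j` exceeds `(n + c) / 2`, the maximum cannot be placed early enough to contribute and the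
count stays constant. -/
lemma ncard_risingAvoiders (c : ℕ) (hc : c ≤ 1) (n j : ℕ) (hj : j ≤ n) :
    ((risingAvoiders c n (n - j)).ncard : ℤ) = ballot (n + c) (min j ((n + c) / 2)) := by
  induction n generalizing j with
  | zero =>
    obtain rfl : j = 0 := by omega
    simp [risingAvoiders_self, ballot]
  | succ n ih =>
    induction j with
    | zero => simp [risingAvoiders_self, ballot]
    | succ j ihj =>
      have ihj := ihj (by omega)
      rcases Nat.eq_or_lt_of_le (Nat.le_of_succ_le_succ hj) with rfl | hlt
      · rw [Nat.add_sub_cancel_left] at ihj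
        rw [Nat.sub_self, risingAvoiders_zero_eq_one, ihj]
        -- For `j > 0`, `c ≤ 1` gives `(j + 1 + c) / 2 ≤ j`, so both minima are already saturated.
        rcases Nat.eq_zero_or_pos j with rfl | hj0
        · interval_cases c <;> simp [ballot]
        · congr 1
          omega
      · have h := ncard_risingAvoiders_succ c (n := n) ⟨n - (j + 1), by omega⟩
        simp only at h
        rw [show n + 1 - (j + 1) = n - (j + 1) + 1 by omega, h,
          show n - (j + 1) + 2 = n + 1 - j by omega, Nat.cast_add, ihj]
        by_cases hb : 2 * (j + 1) ≤ n + c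
        · rw [if_pos (show n ≤ 2 * (n - (j + 1)) + c by omega), ih (j + 1) hlt, min_eq_left (a := j) (by omega),
            min_eq_left (a := j + 1) (b := (n + c) / 2) (by omega),
            min_eq_left (a := j + 1) (by omega), show n + 1 + c = n + c + 1 by omega, ballot_succ_succ]
        · rw [if_neg (show ¬n ≤ 2 * (n - (j + 1)) + c by omega), Nat.cast_zero, add_zero]
          -- On the boundary the index still grows by one, but the added ballot number vanishes.
          by_cases hd : 2 * (j + 1) = n + 1 + c
          · rw [min_eq_left (a := j) (by omega), min_eq_left (a := j + 1) (by omega),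
              show n + 1 + c = (2 * j + 1) + 1 by omega, ballot_succ_succ, ballot_diag, add_zero]
          · congr 1
            omega

lemma ncard_boundedAvoiders (c : ℕ) (hc : c ≤ 1) (n : ℕ) :
    ((boundedAvoiders c n).ncard : ℚ) = seqA047749 (n + c) := by
  have h0 : boundedAvoiders c n = risingAvoiders c n (n - n) := by
    rw [Nat.sub_self]
    ext σ
    exact ⟨fun h => ⟨h, fun i j _ hj => absurd hj (Nat.not_lt_zero _)⟩, fun h => h.1⟩
  rw [h0, ← Int.cast_natCast, ncard_risingAvoiders c hc n n le_rfl, ← ballot_half]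
  rcases Nat.eq_zero_or_pos n with rfl | hn
  · interval_cases c <;> simp
  · rw [min_eq_right (by omega)]

/-! ### Dumont permutations as merged pairs -/

section Merge

variable {n : ℕ}

/-- The `i`-th odd position (positions count from zero). -/
def oddPos (i : Fin n) : Fin (2 * n) := ⟨2 * i + 1, by omega⟩

/-- The `i`-th even position, counted from the right end. -/
def evenPos (i : Fin n) : Fin (2 * n) := ⟨2 * i.rev, by omega⟩

/-- The `i`-th value of the lower half. -/
def lowValue (i : Fin n) : Fin (2 * n) := ⟨i, by omega⟩

/-- The `i`-th value of the upper half, counted from the top. -/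
def highValue (i : Fin n) : Fin (2 * n) := ⟨2 * n - 1 - i, by omega⟩

lemma oddPos_lt_oddPos {i j : Fin n} : oddPos i < oddPos j ↔ i < j := by
  simp only [oddPos, Fin.lt_def]; omega

lemma evenPos_lt_evenPos {i j : Fin n} : evenPos i < evenPos j ↔ j < i := by
  simp only [evenPos, Fin.lt_def, Fin.val_rev]; omega

lemma lowValue_lt_lowValue {i j : Fin n} : lowValue i < lowValue j ↔ i < j := Iff.rfl

lemma highValue_lt_highValue {i j : Fin n} : highValue i < highValue j ↔ j < i := by
  simp only [highValue, Fin.lt_def]; omega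

lemma lowValue_lt_highValue (i j : Fin n) : lowValue i < highValue j := by
  simp only [lowValue, highValue, Fin.lt_def]; omega

/-- Positions split into odd and even ones. -/
noncomputable def positionEquiv (n : ℕ) : Fin n ⊕ Fin n ≃ Fin (2 * n) :=
  Equiv.ofBijective (Sum.elim oddPos evenPos) <| by
    rw [Fintype.bijective_iff_injective_and_card]
    refine ⟨?_, by simp [two_mul]⟩
    rintro (i | i) (j | j) h <;>
      simp only [Sum.elim_inl, Sum.elim_inr, oddPos, evenPos, Fin.mk.injEq, Fin.val_rev] at h <;>
      first
      | omega
      | exact congrArg _ (Fin.ext (by omega))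

/-- Values split into a lower and an upper half. -/
noncomputable def valueEquiv (n : ℕ) : Fin n ⊕ Fin n ≃ Fin (2 * n) :=
  Equiv.ofBijective (Sum.elim lowValue highValue) <| by
    rw [Fintype.bijective_iff_injective_and_card]
    refine ⟨?_, by simp [two_mul]⟩
    rintro (i | i) (j | j) h <;>
      simp only [Sum.elim_inl, Sum.elim_inr, lowValue, highValue, Fin.mk.injEq] at h <;>
      first
      | omega
      | exact congrArg _ (Fin.ext (by omega))

lemma eq_oddPos_or_eq_evenPos (p : Fin (2 * n)) :
    (∃ i, p = oddPos i) ∨ ∃ i, p = evenPos i := by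
  obtain ⟨i | i, rfl⟩ := (positionEquiv n).surjective p
  · exact Or.inl ⟨i, rfl⟩
  · exact Or.inr ⟨i, rfl⟩

/-- The permutation acting as `e` from odd positions to the lower half and as `o` from even
positions to the upper half. -/
noncomputable def mergePerm (e o : Equiv.Perm (Fin n)) : Equiv.Perm (Fin (2 * n)) :=
  (positionEquiv n).symm.trans ((Equiv.sumCongr e o).trans (valueEquiv n))

lemma mergePerm_oddPos (e o : Equiv.Perm (Fin n)) (i : Fin n) :
    mergePerm e o (oddPos i) = lowValue (e i) := by
  have : (positionEquiv n).symm (oddPos i) = Sum.inl i := by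
    rw [Equiv.symm_apply_eq]; rfl
  simp only [mergePerm, Equiv.trans_apply, this]
  rfl

lemma mergePerm_evenPos (e o : Equiv.Perm (Fin n)) (i : Fin n) :
    mergePerm e o (evenPos i) = highValue (o i) := by
  have : (positionEquiv n).symm (evenPos i) = Sum.inr i := by
    rw [Equiv.symm_apply_eq]; rfl
  simp only [mergePerm, Equiv.trans_apply, this]
  rfl

lemma mergePerm_injective {e o e' o' : Equiv.Perm (Fin n)} (h : mergePerm e o = mergePerm e' o') :
    e = e' ∧ o = o' := by
  constructor
  · ext i
    have := congrArg (fun π : Equiv.Perm (Fin (2 * n)) => (π (oddPos i) : ℕ)) h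
    simpa [mergePerm_oddPos, lowValue] using this
  · ext i
    have := congrArg (fun π : Equiv.Perm (Fin (2 * n)) => (π (evenPos i) : ℕ)) h
    simp only [mergePerm_evenPos, highValue] at this
    omega

lemma isDumontSecondKind_mergePerm_iff (e o : Equiv.Perm (Fin n)) :
    IsDumontSecondKind (mergePerm e o) ↔
      (∀ i, (e i : ℕ) ≤ 2 * (i : ℕ) + 0) ∧ ∀ i, (o i : ℕ) ≤ 2 * (i : ℕ) + 1 := by
  constructor
  · intro h
    refine ⟨fun i => ?_, fun i => ?_⟩
    · have := (h (oddPos i)).2 ⟨i, rfl⟩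
      rw [mergePerm_oddPos] at this
      simp only [lowValue, oddPos, Fin.lt_def] at this
      omega
    · have := (h (evenPos i)).1 ⟨i.rev, two_mul _⟩
      rw [mergePerm_evenPos] at this
      simp only [highValue, evenPos, Fin.le_def, Fin.val_rev] at this
      omega
  · rintro ⟨he, ho⟩ p
    rcases eq_oddPos_or_eq_evenPos p with ⟨i, rfl⟩ | ⟨i, rfl⟩
    · refine ⟨fun h => ?_, fun _ => ?_⟩
      · rw [Nat.even_iff] at h
        simp only [oddPos] at h
        omega
      · have := he i
        rw [mergePerm_oddPos]
        simp only [lowValue, oddPos, Fin.lt_def]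
        omega
    · refine ⟨fun _ => ?_, fun h => ?_⟩
      · have := ho i
        rw [mergePerm_evenPos]
        simp only [highValue, evenPos, Fin.le_def, Fin.val_rev]
        omega
      · rw [Nat.odd_iff] at h
        simp only [evenPos] at h
        omega

/-- Inversions of a bounded `213`-avoider end in the second half. -/
lemma le_of_inversion {c : ℕ} {σ : Equiv.Perm (Fin n)} (hσ : σ ∈ boundedAvoiders c n)
    {i j : Fin n} (hij : i < j) (h : σ j < σ i) : n + 1 ≤ 2 * (j : ℕ) + c := by
  obtain ⟨m, rfl⟩ : ∃ m, n = m + 1 := ⟨n - 1, by omega⟩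
  obtain ⟨q, hq⟩ := σ.surjective (Fin.last m)
  -- The maximum lies left of `j`, since after an inversion it would complete a 213; its own bound
  -- then pushes `j` to the right.
  have hqj : q < j := by
    rcases lt_trichotomy q j with hlt | rfl | hgt
    · exact hlt
    · rw [hq] at h
      exact absurd h (not_lt.2 (Fin.le_last _))
    · refine absurd ?_ (hσ.2 i j q hij hgt h)
      rw [hq]
      exact lt_of_le_of_ne (Fin.le_last _) fun h' =>
        (hij.trans hgt).ne (σ.injective (h'.trans hq.symm))
  have := hσ.1 q
  rw [hq, Fin.val_last] at this
  rw [Fin.lt_def] at hqj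
  omega

/-- A 2143 whose 3 is low, or whose 2 is high, contains a 213 of `e` or of `o`. Otherwise its 21 is
an inversion of `e` and its 43 one of `o`; by `le_of_inversion` the former ends too far right to
precede the latter. -/
lemma avoids2143_mergePerm {e o : Equiv.Perm (Fin n)} (he : e ∈ boundedAvoiders 0 n)
    (ho : o ∈ boundedAvoiders 1 n) : Avoids2143 (mergePerm e o) := by
  rintro ⟨i₁, i₂, i₃, i₄, h₁₂, h₂₃, h₃₄, h21, h14, h43⟩
  have low : ∀ {i : Fin n} {p}, mergePerm e o p < mergePerm e o (oddPos i) →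
      ∃ j, p = oddPos j := by
    intro i p h
    rcases eq_oddPos_or_eq_evenPos p with hp | ⟨j, rfl⟩
    · exact hp
    · rw [mergePerm_oddPos, mergePerm_evenPos] at h
      exact absurd h (lt_asymm (lowValue_lt_highValue _ _))
  rcases eq_oddPos_or_eq_evenPos i₄ with ⟨l, rfl⟩ | ⟨l, rfl⟩
  · obtain ⟨i, rfl⟩ := low h14
    obtain ⟨j, rfl⟩ := low h21
    simp only [mergePerm_oddPos, lowValue_lt_lowValue] at h21 h14
    exact he.2 i j l (oddPos_lt_oddPos.1 h₁₂) (oddPos_lt_oddPos.1 (h₂₃.trans h₃₄)) h21 h14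
  · rcases eq_oddPos_or_eq_evenPos i₃ with ⟨k, rfl⟩ | ⟨k, rfl⟩
    · obtain ⟨j, hj⟩ := low h43
      have := congrArg Fin.val hj
      simp only [evenPos, oddPos] at this
      omega
    rcases eq_oddPos_or_eq_evenPos i₁ with ⟨i, rfl⟩ | ⟨i, rfl⟩
    · obtain ⟨j, rfl⟩ := low h21
      simp only [mergePerm_oddPos, mergePerm_evenPos, lowValue_lt_lowValue,
        highValue_lt_highValue] at h21 h43
      have h1 := le_of_inversion he (oddPos_lt_oddPos.1 h₁₂) h21
      have h2 := le_of_inversion ho (evenPos_lt_evenPos.1 h₃₄) h43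
      simp only [oddPos, evenPos, Fin.lt_def, Fin.val_rev] at h₂₃
      omega
    · simp only [mergePerm_evenPos, highValue_lt_highValue] at h14 h43
      exact ho.2 l k i (evenPos_lt_evenPos.1 h₃₄) (evenPos_lt_evenPos.1 (h₁₂.trans h₂₃)) h43 h14

/-- A 213 of `e` extends by the high value just before its last entry, as the 4. A 213 of `o`
appears as 132 and extends by the low value just after its first entry, as the 1 of 2143. -/
lemma avoids213_of_avoids2143_mergePerm {e o : Equiv.Perm (Fin n)}
    (h : Avoids2143 (mergePerm e o)) : Avoids213 e ∧ Avoids213 o := by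
  constructor
  · intro i j k hij hjk h1 h2
    refine h ⟨oddPos i, oddPos j, evenPos k.rev, oddPos k, oddPos_lt_oddPos.2 hij, ?_, ?_, ?_, ?_,
      ?_⟩
    · simp only [oddPos, evenPos, Fin.lt_def, Fin.rev_rev] at hjk ⊢
      omega
    · simp only [oddPos, evenPos, Fin.lt_def, Fin.rev_rev]
      omega
    · rwa [mergePerm_oddPos, mergePerm_oddPos]
    · rwa [mergePerm_oddPos, mergePerm_oddPos]
    · rw [mergePerm_oddPos, mergePerm_evenPos]
      exact lowValue_lt_highValue _ _
  · intro i j k hij hjk h1 h2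
    refine h ⟨evenPos k, oddPos k.rev, evenPos j, evenPos i, ?_, ?_, evenPos_lt_evenPos.2 hij,
      ?_, ?_, ?_⟩
    · simp only [oddPos, evenPos, Fin.lt_def]
      omega
    · simp only [oddPos, evenPos, Fin.lt_def, Fin.val_rev] at hjk ⊢
      omega
    · rw [mergePerm_oddPos, mergePerm_evenPos]
      exact lowValue_lt_highValue _ _
    · rw [mergePerm_evenPos, mergePerm_evenPos]
      exact highValue_lt_highValue.2 h2
    · rw [mergePerm_evenPos, mergePerm_evenPos]
      exact highValue_lt_highValue.2 h1

/-- If an even position has a larger odd-position value against it, the Dumont bounds put the even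
position in an earlier pair `2 r, 2 r + 1`; the two pairs together then form a 2143. -/
lemma apply_oddPos_lt_apply_evenPos {π : Equiv.Perm (Fin (2 * n))} (hd : IsDumontSecondKind π)
    (ha : Avoids2143 π) (i j : Fin n) : π (oddPos i) < π (evenPos j) := by
  have hodd : ∀ i : Fin n, (π (oddPos i) : ℕ) < 2 * i + 1 := fun i => (hd (oddPos i)).2 ⟨i, rfl⟩
  have heven : ∀ i : Fin n, 2 * (i.rev : ℕ) ≤ π (evenPos i) := fun i =>
    (hd (evenPos i)).1 ⟨i.rev, two_mul _⟩
  by_contra hlt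
  rw [Fin.lt_def] at hlt
  have h1 := hodd i
  have h2 := heven j
  have h3 := hodd j.rev
  have h4 := heven i.rev
  rw [Fin.rev_rev] at h4
  have hne3 : π (evenPos j) ≠ π (oddPos i) := fun h => by
    have := congrArg Fin.val (π.injective h)
    simp only [oddPos, evenPos] at this
    omega
  rw [ne_eq, Fin.ext_iff] at hne3
  by_cases hij : (j.rev : ℕ) < i
  · have hne1 : π (oddPos j.rev) ≠ π (evenPos j) := fun h => by
      have := congrArg Fin.val (π.injective h)
      simp only [oddPos, evenPos] at this
      omega
    have hne2 : π (oddPos i) ≠ π (evenPos i.rev) := fun h => by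
      have := congrArg Fin.val (π.injective h)
      simp only [oddPos, evenPos, Fin.rev_rev] at this
      omega
    rw [ne_eq, Fin.ext_iff] at hne1 hne2
    refine ha ⟨evenPos j, oddPos j.rev, evenPos i.rev, oddPos i, ?_, ?_, ?_, ?_, ?_, ?_⟩
    · simp only [oddPos, evenPos, Fin.lt_def]
      omega
    · simp only [oddPos, evenPos, Fin.rev_rev, Fin.lt_def]
      omega
    · simp only [oddPos, evenPos, Fin.rev_rev, Fin.lt_def]
      omega
    all_goals
      rw [Fin.lt_def]
      omega
  · omega

lemma exists_mergePerm_eq {π : Equiv.Perm (Fin (2 * n))}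
    (h : ∀ i j : Fin n, π (oddPos i) < π (evenPos j)) : ∃ e o, mergePerm e o = π := by
  let τ : Equiv.Perm (Fin n ⊕ Fin n) :=
    (positionEquiv n).trans (π.trans (valueEquiv n).symm)
  have hτ : Set.MapsTo τ (Set.range Sum.inl) (Set.range Sum.inl) := by
    rintro _ ⟨i, rfl⟩
    have hlt : (π (oddPos i) : ℕ) < n := by
      by_contra hge
      -- Pigeonhole: the `n` values at even positions would all lie among the `n - 1` values above
      -- `n`.
      have hmem : ∀ j : Fin n, (π (evenPos j) : ℕ) - (n + 1) < n - 1 := fun j => by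
        have := h i j
        rw [Fin.lt_def] at this
        omega
      have hinj : Function.Injective
          fun j : Fin n => (⟨_, hmem j⟩ : Fin (n - 1)) := by
        intro j k hjk
        have hjk := congrArg Fin.val hjk
        simp only at hjk
        have h1 := h i j
        have h2 := h i k
        rw [Fin.lt_def] at h1 h2
        have := congrArg Fin.val (π.injective (Fin.ext (by omega) : π (evenPos j) = π (evenPos k)))
        simp only [evenPos, Fin.val_rev] at this
        exact Fin.ext (by omega)
      have := Fintype.card_le_of_injective _ hinj
      simp only [Fintype.card_fin] at this
      omega
    refine ⟨⟨π (oddPos i), hlt⟩, ?_⟩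
    exact ((valueEquiv n).symm_apply_eq.2 rfl).symm
  obtain ⟨⟨e, o⟩, heo⟩ := Equiv.Perm.mem_sumCongrHom_range_of_perm_mapsTo_inl hτ
  refine ⟨e, o, ?_⟩
  have heo : Equiv.sumCongr e o = τ := heo
  rw [mergePerm, heo]
  ext p
  simp [τ]

end Merge

lemma card_dumontAvoiding2143 (n : ℕ) :
    (Nat.card (DumontAvoiding2143 n) : ℚ) = seqA047749 n * seqA047749 (n + 1) := by
  have hmem : ∀ e o : Equiv.Perm (Fin n),
      (IsDumontSecondKind (mergePerm e o) ∧ Avoids2143 (mergePerm e o)) ↔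
        e ∈ boundedAvoiders 0 n ∧ o ∈ boundedAvoiders 1 n := by
    intro e o
    rw [isDumontSecondKind_mergePerm_iff]
    constructor
    · rintro ⟨⟨he, ho⟩, ha⟩
      have := avoids213_of_avoids2143_mergePerm ha
      exact ⟨⟨he, this.1⟩, ⟨ho, this.2⟩⟩
    · rintro ⟨he, ho⟩
      exact ⟨⟨he.1, ho.1⟩, avoids2143_mergePerm he ho⟩
  have hbij : Function.Bijective
      (fun p : boundedAvoiders 0 n × boundedAvoiders 1 n =>
        (⟨mergePerm p.1 p.2, (hmem _ _).2 ⟨p.1.2, p.2.2⟩⟩ : DumontAvoiding2143 n)) := by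
    constructor
    · intro p q h
      have := mergePerm_injective (congrArg Subtype.val h)
      exact Prod.ext (Subtype.ext this.1) (Subtype.ext this.2)
    · rintro ⟨π, hπ⟩
      obtain ⟨e, o, rfl⟩ := exists_mergePerm_eq (apply_oddPos_lt_apply_evenPos hπ.1 hπ.2)
      have := (hmem e o).1 hπ
      exact ⟨⟨⟨e, this.1⟩, ⟨o, this.2⟩⟩, rfl⟩
  have hcard : Nat.card (boundedAvoiders 0 n) * Nat.card (boundedAvoiders 1 n) =
      Nat.card (DumontAvoiding2143 n) := by
    rw [← Nat.card_prod]
    exact Nat.card_congr (Equiv.ofBijective _ hbij)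
  rw [← hcard, Nat.cast_mul, Nat.card_coe_set_eq, Nat.card_coe_set_eq, ncard_boundedAvoiders 0 (by omega),
    ncard_boundedAvoiders 1 le_rfl, add_zero]

instance (n : ℕ) : Finite (DumontAvoiding2143 n) := Subtype.finite

instance (n : ℕ) : Finite (SubexcedentFaroWord n) := Subtype.finite

theorem theorem12 (n : ℕ) :
    Nonempty (SubexcedentFaroWord n ≃ DumontAvoiding2143 n) ∧
    (Nat.card (SubexcedentFaroWord n) : ℚ) = seqA047749 n * seqA047749 (n + 1) ∧
    (Nat.card (DumontAvoiding2143 n) : ℚ) = seqA047749 n * seqA047749 (n + 1) := by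
  have hF := card_subexcedentFaroWord n
  have hD := card_dumontAvoiding2143 n
  have hcard : Nat.card (SubexcedentFaroWord n) = Nat.card (DumontAvoiding2143 n) := by
    exact_mod_cast hF.trans hD.symm
  exact ⟨Finite.card_eq.1 hcard, hF, hD⟩
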